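/- **Definitions.** A \emph{distribution instance} $G=(\mathcal I^{(0)},\mathcal I^{(1)};\mathcal F;w)$ is a finite bipartite graph with vertex sides $\mathcal I^{(0)},\mathcal I^{(1)}$, edge set $\mathcal F\subseteq\mathcal I^{(0)}\times\mathcal I^{(1)}$, no isolated vertices, and positive vertex weights $w$ that sum to $1$ on each side. A \emph{distribution refinement pair} is a pair $(\alpha^{(0)},\alpha^{(1)})$ of probability distributions on $\mathcal F$ such that for each $\iota\in\{0,1\}$ and each $i\in\mathcal I^{(\iota)}$ we have $\sum_{f\in\mathcal F:\, i\in f}\alpha^{(\iota)}(f)=w(i)$. A \emph{divergence} $\mathsf D$ assigns to any two probability distributions $P,Q$ on the same finite sample space a value $\mathsf D(P\|Q)\in[-\infty,\infty]$; it satisfies the \emph{data processing inequality} if $\mathsf D(\varphi(P)\|\varphi(Q))\le\mathsf D(P\|Q)$ for all finite $\Omega,\widehat\Omega$, all distributions $P,Q$ on $\Omega$ and every post-processing $\varphi$ from $\Omega$ to $\widehat\Omega$, deterministic or randomized (that is, every Markov kernel). A refinement pair of $G$ is \emph{universally closest} if, for every divergence $\mathsf D$ satisfying the data processing inequality, it minimizes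 $\mathsf D(\alpha^{(0)}\|\alpha^{(1)})$ among all distribution refinement pairs of $G$. The \emph{minimum quadratic-cost flow problem} asks, for a directed graph with edge capacities $u_e\ge 0$, cost coefficients $a_e\ge 0$ and vertex demands $d_v$ for which a feasible flow exists, for a feasible flow (that is, $0\le f_e\le u_e$, and the net inflow at each vertex $v$ is $d_v$) minimizing $\sum_e a_e f_e^2$. The size of such a network is its number of vertices plus its number of edges. Running times are counted in steps of a real RAM with exact real arithmetic. **Theorem (Universally Closest Refinement Pair).** 1. Every distribution instance has a universally closest refinement pair. 2. Such a pair can be returned using any algorithm for the minimum quadratic-cost flow problem (such as the near-linear time algorithm of Chen et al.). Precisely, there are a real-RAM program and a constant $C$ such that on every distribution instance with $m$ edges, given by its vertex weights and its edges listed in any order, the program performs at most $Cm$ steps and exactly one call of the flow algorithm, on a feasible network of size at most $Cm$; and if the answer to this call is an optimal flow, the program returns a universally closest refinement pair. Consequently, if the flow algorithm takes time at most $T(s)$ on networks of size $s$, where $T(s)=s^{1+o(1)}$, then the total running time is $m^{1+o(1)}$. -/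

import Mathlib

universe u

namespace ClosestRefinement

/-- Probability distributions on a finite sample space. -/
abbrev FinDist (Ω : Type u) [Fintype Ω] : Type u := stdSimplex ℝ Ω

/-- The distribution obtained from `P` by (possibly randomized) post-processing: a sample `x` of `P`
is replaced by a sample of the distribution `κ x`. -/
def FinDist.process {Ω Ω' : Type u} [Fintype Ω] [Fintype Ω'] (P : FinDist Ω)
    (κ : Ω → FinDist Ω') : FinDist Ω' :=
  ⟨fun y => ∑ x, P.1 x * (κ x).1 y,
    fun y => Finset.sum_nonneg fun x _ => mul_nonneg (P.2.1 x) ((κ x).2.1 y), by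
      rw [Finset.sum_comm]
      simp_rw [← Finset.mul_sum, (κ _).2.2, mul_one]
      exact P.2.2⟩

/-- A divergence notion: a value `D Ω P Q` for all distributions `P`, `Q` on the same finite sample
space. The value may be infinite, as for the Kullback–Leibler divergence; no symmetry, continuity
or normalization is required. -/
def Divergence : Type (u + 1) :=
  ∀ (Ω : Type u) [Fintype Ω], FinDist Ω → FinDist Ω → EReal

/-- The data processing inequality: post-processing does not increase the divergence. -/
def Divergence.DataProcessing (D : Divergence.{u}) : Prop :=
  ∀ (Ω Ω' : Type u) [Fintype Ω] [Fintype Ω'] (κ : Ω → FinDist Ω') (P Q : FinDist Ω),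
    D Ω' (P.process κ) (Q.process κ) ≤ D Ω P Q

/-- A distribution instance: a finite bipartite graph with positive vertex weights that sum to one
on each side. -/
structure DistInstance (I₀ I₁ : Type u) [Fintype I₀] [Fintype I₁] where
  edges : Finset (I₀ × I₁)
  w₀ : I₀ → ℝ
  w₁ : I₁ → ℝ
  w₀_pos : ∀ i, 0 < w₀ i
  w₁_pos : ∀ j, 0 < w₁ j
  sum_w₀ : ∑ i, w₀ i = 1
  sum_w₁ : ∑ j, w₁ j = 1

namespace DistInstance

variable {I₀ I₁ : Type u} [Fintype I₀] [Fintype I₁] (G : DistInstance I₀ I₁)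

/-- Every vertex has a neighbour. -/
def NoIsolated : Prop :=
  (∀ i, ∃ j, (i, j) ∈ G.edges) ∧ (∀ j, ∃ i, (i, j) ∈ G.edges)

open scoped Classical in
/-- Each non-isolated vertex of side `0` distributes its weight among its incident edges. -/
def IsRefinement₀ (α : FinDist G.edges) : Prop :=
  ∀ i, (∃ j, (i, j) ∈ G.edges) → ∑ f : G.edges with f.1.1 = i, α.1 f = G.w₀ i

open scoped Classical in
/-- Each non-isolated vertex of side `1` distributes its weight among its incident edges. -/
def IsRefinement₁ (α : FinDist G.edges) : Prop :=
  ∀ j, (∃ i, (i, j) ∈ G.edges) → ∑ f : G.edges with f.1.2 = j, α.1 f = G.w₁ j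

/-- A distribution refinement pair: two distributions on the edges that refine the vertex weights of
side `0` and of side `1`, respectively. -/
def IsRefinementPair (α₀ α₁ : FinDist G.edges) : Prop :=
  G.IsRefinement₀ α₀ ∧ G.IsRefinement₁ α₁

/-- A distribution refinement pair that is closest with respect to all divergences satisfying the
data processing inequality. -/
def IsUniversallyClosest (α₀ α₁ : FinDist G.edges) : Prop :=
  G.IsRefinementPair α₀ α₁ ∧
    ∀ D : Divergence.{u}, D.DataProcessing →
      ∀ β₀ β₁ : FinDist G.edges, G.IsRefinementPair β₀ β₁ → D G.edges α₀ α₁ ≤ D G.edges β₀ β₁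

end DistInstance

/-- The data of a minimum quadratic-cost flow problem on a directed (multi)graph with vertices
`0, …, numV - 1`: capacities and cost coefficients of the edges, and demands of the vertices. -/
structure FlowNetwork where
  numV : ℕ
  numE : ℕ
  tail : Fin numE → ℕ
  head : Fin numE → ℕ
  demand : Fin numV → ℝ
  cap : Fin numE → ℝ
  quad : Fin numE → ℝ

namespace FlowNetwork

variable (N : FlowNetwork)

/-- The number of vertices and edges. -/
def size : ℕ := N.numV + N.numE

/-- Feasible flows: capacities are respected and the net inflow of each vertex is its demand. -/
def IsFlow (f : Fin N.numE → ℝ) : Prop :=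
  (∀ e, 0 ≤ f e ∧ f e ≤ N.cap e) ∧
    ∀ v : Fin N.numV, (∑ e with N.head e = v, f e) - ∑ e with N.tail e = v, f e = N.demand v

/-- The cost `∑ aₑ fₑ²` of a flow. -/
def cost (f : Fin N.numE → ℝ) : ℝ := ∑ e, N.quad e * f e ^ 2

/-- Minimum-cost flows. -/
def IsOptimal (f : Fin N.numE → ℝ) : Prop :=
  N.IsFlow f ∧ ∀ g, N.IsFlow g → N.cost f ≤ N.cost g

/-- A legitimate instance of the problem: the edges join vertices of the network, the capacities and
cost coefficients are nonnegative, and there is a feasible flow. -/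
def IsProper : Prop :=
  (∀ e, N.tail e < N.numV ∧ N.head e < N.numV) ∧ (∀ e, 0 ≤ N.cap e) ∧ (∀ e, 0 ≤ N.quad e) ∧
    ∃ f, N.IsFlow f

end FlowNetwork

/-- A flow solver returns some edge vector for every network. Whether it is an optimal flow is stated
separately. -/
abbrev FlowSolver : Type := (N : FlowNetwork) → Fin N.numE → ℝ

/-- The memory of a real RAM: registers and arrays of natural numbers (for indices) and registers and
arrays of real numbers, which are exact. -/
structure Memory where
  ireg : ℕ → ℕ
  rreg : ℕ → ℝ
  iarr : ℕ → ℕ → ℕ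
  rarr : ℕ → ℕ → ℝ

/-- Arithmetic operations on reals. -/
inductive RealOp where
  | add
  | sub
  | mul
  | div

/-- The value of an arithmetic operation. -/
noncomputable def RealOp.eval : RealOp → ℝ → ℝ → ℝ
  | add, a, b => a + b
  | sub, a, b => a - b
  | mul, a, b => a * b
  | div, a, b => a / b

/-- Programs of a real RAM that may call a flow solver. -/
inductive Program where
  /-- index register `x := c` -/
  | iconst (x c : ℕ)
  /-- index registers `x := y + z` -/
  | iadd (x y z : ℕ)
  /-- index register `x := a[i]` for the index array `a` and the index register `i` -/
  | iload (x a i : ℕ)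
  /-- `a[i] := x` for the index array `a` and the index registers `i`, `x` -/
  | istore (a i x : ℕ)
  /-- real register `x := c` -/
  | rconst (x c : ℕ)
  /-- real registers `x := y o z` -/
  | rop (o : RealOp) (x y z : ℕ)
  /-- real register `x := a[i]` for the real array `a` and the index register `i` -/
  | rload (x a i : ℕ)
  /-- `a[i] := x` for the real array `a`, the index register `i` and the real register `x` -/
  | rstore (a i x : ℕ)
  /-- sequential composition -/
  | seq (p q : Program)
  /-- `for x := 0, …, n - 1 do p`, where `n` is the content of the index register `b` at the start -/
  | loop (x b : ℕ) (p : Program)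
  /-- call the flow solver -/
  | solve

/-- The network that a call of the solver refers to: the numbers of vertices and edges are in the
index registers `0`, `1`, the tails and heads in the index arrays `0`, `1`, and the demands,
capacities and cost coefficients in the real arrays `0`, `1`, `2`. -/
def Memory.network (s : Memory) : FlowNetwork where
  numV := s.ireg 0
  numE := s.ireg 1
  tail e := s.iarr 0 e
  head e := s.iarr 1 e
  demand v := s.rarr 0 v
  cap e := s.rarr 1 e
  quad e := s.rarr 2 e

/-- A state of a computation: the memory, the number of steps so far (not counting the work of the
solver), and the networks for which the solver was called so far. -/
structure Run where
  mem : Memory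
  steps : ℕ
  queries : List FlowNetwork

/-- Continue with the memory `s`, at the cost of one step. -/
def Run.step (r : Run) (s : Memory) : Run := ⟨s, r.steps + 1, r.queries⟩

open Function in
/-- Execution of a program. Each elementary instruction, each loop and each iteration of a loop costs
one step. The solver's answer is stored in the real array `3`. -/
noncomputable def Program.exec (S : FlowSolver) : Program → Run → Run
  | iconst x c, r => r.step { r.mem with ireg := update r.mem.ireg x c }
  | iadd x y z, r =>
      r.step { r.mem with ireg := update r.mem.ireg x (r.mem.ireg y + r.mem.ireg z) }
  | iload x a i, r =>
      r.step { r.mem with ireg := update r.mem.ireg x (r.mem.iarr a (r.mem.ireg i)) }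
  | istore a i x, r =>
      r.step { r.mem with
        iarr := update r.mem.iarr a (update (r.mem.iarr a) (r.mem.ireg i) (r.mem.ireg x)) }
  | rconst x c, r => r.step { r.mem with rreg := update r.mem.rreg x c }
  | rop o x y z, r =>
      r.step { r.mem with rreg := update r.mem.rreg x (o.eval (r.mem.rreg y) (r.mem.rreg z)) }
  | rload x a i, r =>
      r.step { r.mem with rreg := update r.mem.rreg x (r.mem.rarr a (r.mem.ireg i)) }
  | rstore a i x, r =>
      r.step { r.mem with
        rarr := update r.mem.rarr a (update (r.mem.rarr a) (r.mem.ireg i) (r.mem.rreg x)) }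
  | seq p q, r => q.exec S (p.exec S r)
  | loop x b p, r =>
      (List.range (r.mem.ireg b)).foldl
        (fun r k => p.exec S (r.step { r.mem with ireg := update r.mem.ireg x k }))
        (r.step r.mem)
  | solve, r =>
      ⟨{ r.mem with
          rarr := update r.mem.rarr 3 fun k =>
            if h : k < r.mem.network.numE then S r.mem.network ⟨k, h⟩ else r.mem.rarr 3 k },
        r.steps + 1, r.queries ++ [r.mem.network]⟩

/-- The input memory for a distribution instance whose edges are listed in the order `e`: the numbers
of vertices of side `0`, vertices of side `1` and edges are in the index registers `2`, `3`, `4`, the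
end points of the edges in the index arrays `2`, `3`, the weights of the two sides in the real arrays
`4`, `5`, and all other cells are zero. -/
def DistInstance.encode {n₀ n₁ m : ℕ} (G : DistInstance (Fin n₀) (Fin n₁))
    (e : Fin m ≃ G.edges) : Memory where
  ireg
    | 2 => n₀
    | 3 => n₁
    | 4 => m
    | _ => 0
  rreg _ := 0
  iarr
    | 2 => fun k => if h : k < m then ((e ⟨k, h⟩).1.1 : ℕ) else 0
    | 3 => fun k => if h : k < m then ((e ⟨k, h⟩).1.2 : ℕ) else 0
    | _ => fun _ => 0
  rarr
    | 4 => fun k => if h : k < n₀ then G.w₀ ⟨k, h⟩ else 0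
    | 5 => fun k => if h : k < n₁ then G.w₁ ⟨k, h⟩ else 0
    | _ => fun _ => 0

/-- The run of a program on a distribution instance. -/
noncomputable def Program.run (p : Program) (S : FlowSolver) {n₀ n₁ m : ℕ}
    (G : DistInstance (Fin n₀) (Fin n₁)) (e : Fin m ≃ G.edges) : Run :=
  p.exec S ⟨G.encode e, 0, []⟩

/-- The run ends with the pair `(α₀, α₁)` in the real arrays `6`, `7`, edge by edge. -/
def Run.Returns (r : Run) {n₀ n₁ m : ℕ} {G : DistInstance (Fin n₀) (Fin n₁)}
    (e : Fin m ≃ G.edges) (α₀ α₁ : FinDist G.edges) : Prop :=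
  ∀ k : Fin m, r.mem.rarr 6 k = α₀.1 (e k) ∧ r.mem.rarr 7 k = α₁.1 (e k)

/-- The total running time if the solver takes time `T s` on a network of size `s`. -/
def Run.time (r : Run) (T : ℕ → ℕ) : ℕ := r.steps + (r.queries.map fun N => T N.size).sum

/-- Near-linear growth, `T n = n ^ (1 + o(1))`. -/
def NearLinear (T : ℕ → ℕ) : Prop :=
  ∀ ε : ℝ, 0 < ε → (fun n => (T n : ℝ)) =O[Filter.atTop] fun n : ℕ => (n : ℝ) ^ (1 + ε)

end ClosestRefinement

open ClosestRefinement

/-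
The refinement `α₀` of side `0` is chosen to minimize the energy `∑ j, x j ^ 2 / w₁ j`, where
`x j` is the amount that arrives at the vertex `j` of side `1`. This is a quadratic flow cost. By
the first order condition `α₀` is a Wardrop equilibrium: each vertex `i` of side `0` sends its
weight only to neighbours of least density `ρ j = x j / w₁ j`. Let `σ i` be this least density,
and let `α₁` split each `w₁ j` in proportion to `α₀`, so that the likelihood ratio of `(α₀, α₁)` at
an edge `(i, j)` is `ρ j`.

Any other refinement pair `(β₀, β₁)` can be post-processed into `(α₀, α₁)`. By Blackwell's
criterion it suffices that, whatever the gains `u` and `v` are, some decision rule does at least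
as well against `(β₀, β₁)` as the best rule does against `(α₀, α₁)`. The latter may be taken to be
`y ∘ ρ` for a maximizer `y r` of `r * u + v`, and `y ∘ σ` serves as the former: `ρ = σ` where `α₀`
is positive, functions of `i` and `j` have the same expectations under `β₀` and `β₁` as under `α₀`
and `α₁`, and `v ∘ y` is antitone while `σ ≤ ρ` on all edges.
-/

namespace ClosestRefinement

open Finset Function

section Randomization

theorem mem_of_forall_exists_dotProduct_le {n : Type*} [Fintype n] {K : Set (n → ℝ)}
    (hconv : Convex ℝ K) (hclosed : IsClosed K) {q : n → ℝ}
    (h : ∀ g : n → ℝ, ∃ a ∈ K, g ⬝ᵥ q ≤ g ⬝ᵥ a) : q ∈ K := by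
  classical
  by_contra hq
  obtain ⟨φ, c, hK, hc⟩ := geometric_hahn_banach_closed_point hconv hclosed hq
  have hφ (a : n → ℝ) : φ a = (fun z => φ fun z' => if z = z' then 1 else 0) ⬝ᵥ a := by
    simpa [dotProduct, mul_comm] using φ.toLinearMap.pi_apply_eq_sum_univ a
  obtain ⟨a, ha, hle⟩ := h fun z => φ fun z' => if z = z' then 1 else 0
  rw [← hφ, ← hφ] at hle
  exact (hle.trans_lt (hK a ha)).not_gt hc

-- This is Blackwell's randomization criterion: in every decision problem with gains `g`, some
-- decision rule `d` gains at least as much from the experiment `P` as guessing from `Q`.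
theorem exists_process_eq {ι : Type*} [Fintype ι] {Ω Ω' : Type u} [Fintype Ω] [Fintype Ω']
    (P : ι → FinDist Ω) (Q : ι → FinDist Ω')
    (h : ∀ g : ι → Ω' → ℝ, ∃ d : Ω → Ω',
      ∑ i, ∑ y, g i y * (Q i).1 y ≤ ∑ i, ∑ x, g i (d x) * (P i).1 x) :
    ∃ κ : Ω → FinDist Ω', ∀ i, (P i).process κ = Q i := by
  classical
  let L : (Ω → Ω' → ℝ) →ₗ[ℝ] ι × Ω' → ℝ := LinearMap.pi fun z =>
    ∑ x, (P z.1).1 x • LinearMap.proj (φ := fun _ => ℝ) z.2 ∘ₗ LinearMap.proj x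
  have hL (κ : Ω → Ω' → ℝ) (z) : L κ z = ∑ x, (P z.1).1 x * κ x z.2 := by simp [L]
  let kernels : Set (Ω → Ω' → ℝ) := Set.univ.pi fun _ => stdSimplex ℝ Ω'
  have hcompact : IsCompact kernels := isCompact_univ_pi fun _ => isCompact_stdSimplex ℝ Ω'
  have hconvex : Convex ℝ kernels := convex_pi fun _ _ => convex_stdSimplex ℝ Ω'
  have hmem : (fun z : ι × Ω' => (Q z.1).1 z.2) ∈ L '' kernels := by
    refine mem_of_forall_exists_dotProduct_le (hconvex.linear_image L)
      (hcompact.image L.continuous_of_finiteDimensional).isClosed fun g => ?_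
    obtain ⟨d, hd⟩ := h fun i y => g (i, y)
    refine ⟨_, ⟨fun x => Pi.single (d x) 1, fun x _ => single_mem_stdSimplex ℝ (d x), rfl⟩, ?_⟩
    simp only [dotProduct, hL, Fintype.sum_prod_type, Pi.single_apply, mul_sum]
    refine hd.trans_eq (sum_congr rfl fun i _ => ?_)
    rw [sum_comm]
    simp
  obtain ⟨κ, hκ, hκQ⟩ := hmem
  exact ⟨fun x => ⟨κ x, hκ x trivial⟩, fun i => Subtype.ext <| funext fun y =>
    (hL κ (i, y)).symm.trans (congrFun hκQ (i, y))⟩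

end Randomization

section FirstOrder

open scoped Topology

theorem sum_div_mul_sub_nonneg {ι : Type*} [Fintype ι] {s : Set (ι → ℝ)} (hs : Convex ℝ s)
    {w x y : ι → ℝ} (hmin : IsMinOn (fun z : ι → ℝ => ∑ i, z i ^ 2 / w i) s x) (hx : x ∈ s)
    (hy : y ∈ s) : 0 ≤ ∑ i, x i / w i * (y i - x i) := by
  have hderiv : HasFDerivAt (fun z : ι → ℝ => ∑ i, z i ^ 2 / w i)
      (∑ i, (2 * x i / w i) • ContinuousLinearMap.proj (R := ℝ) (φ := fun _ : ι => ℝ) i) x := by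
    refine HasFDerivAt.fun_sum fun i _ => ?_
    have hproj : HasFDerivAt (fun z : ι → ℝ => z i) (ContinuousLinearMap.proj (R := ℝ) i) x :=
      hasFDerivAt_apply i x
    simpa [comp_def] using ((hasDerivAt_pow 2 (x i)).div_const (w i)).comp_hasFDerivAt x hproj
  have h := hmin.localize.hasFDerivWithinAt_nonneg hderiv.hasFDerivWithinAt
    (sub_mem_posTangentConeAt_of_segment_subset (hs.segment_subset hx hy))
  have : (0 : ℝ) ≤ 2 * ∑ i, x i / w i * (y i - x i) := by
    simpa [mul_sum, mul_div_assoc, mul_assoc] using h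
  linarith

end FirstOrder

theorem antitoneOn_of_forall_mul_add_le {α : Type*} {u v : α → ℝ} {y : ℝ → α}
    (hy : ∀ r z, r * u z + v z ≤ r * u (y r) + v (y r)) :
    AntitoneOn (fun r => v (y r)) (Set.Ici 0) := by
  intro r (hr : 0 ≤ r) r' _ hrr'
  rcases hrr'.eq_or_lt with rfl | hlt
  · rfl
  have h := hy r (y r')
  have h' := hy r' (y r)
  have hu : u (y r) ≤ u (y r') := by nlinarith
  nlinarith

theorem sum_add_sum_le_of_forall_mul_add_le {α X : Type*} [Fintype X] {u v : α → ℝ} {y : ℝ → α}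
    (hy : ∀ r z, r * u z + v z ≤ r * u (y r) + v (y r)) {P Q r : X → ℝ} (hQ : ∀ x, 0 ≤ Q x)
    (hr : ∀ x, P x = r x * Q x) (d : X → α) :
    ∑ x, u (d x) * P x + ∑ x, v (d x) * Q x ≤
      ∑ x, u (y (r x)) * P x + ∑ x, v (y (r x)) * Q x := by
  have hgain (d : X → α) : ∑ x, u (d x) * P x + ∑ x, v (d x) * Q x =
      ∑ x, (r x * u (d x) + v (d x)) * Q x := by
    rw [← sum_add_distrib]
    exact sum_congr rfl fun x _ => by rw [hr]; ring
  rw [hgain, hgain fun x => y (r x)]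
  exact sum_le_sum fun x _ => mul_le_mul_of_nonneg_right (hy _ _) (hQ x)

section Pushforward

variable {X Y : Type*} (π : X → Y)

theorem linearMap_mul_comp [Finite X] [Finite Y] (b : Y → ℝ) (x : X → ℝ) :
    FunOnFinite.linearMap ℝ ℝ π (fun e => x e * b (π e)) =
      fun y => FunOnFinite.linearMap ℝ ℝ π x y * b y := by
  classical
  have := Fintype.ofFinite X
  ext y
  simp only [FunOnFinite.linearMap_apply_apply, sum_mul]
  exact sum_congr rfl fun e he => by rw [(mem_filter.1 he).2]

variable [Fintype X] [Fintype Y]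

theorem sum_comp_mul_eq_sum_mul_linearMap (b : Y → ℝ) (x : X → ℝ) :
    ∑ e, b (π e) * x e = ∑ y, b y * FunOnFinite.linearMap ℝ ℝ π x y := by
  classical
  simp only [FunOnFinite.linearMap_apply_apply, mul_sum]
  rw [← sum_fiberwise univ π]
  exact sum_congr rfl fun y _ => sum_congr rfl fun e he => by rw [(mem_filter.1 he).2]

variable {π}

theorem mem_stdSimplex_of_linearMap_mem {x : X → ℝ} (hx : ∀ e, 0 ≤ x e)
    (h : FunOnFinite.linearMap ℝ ℝ π x ∈ stdSimplex ℝ Y) : x ∈ stdSimplex ℝ X :=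
  ⟨hx, by simpa [h.2] using sum_comp_mul_eq_sum_mul_linearMap π 1 x⟩

end Pushforward

namespace DistInstance

variable {I₀ I₁ : Type u} [Fintype I₀] [Fintype I₁] (G : DistInstance I₀ I₁)

/-- The amounts that the vertices of side `0` send along their edges in total. -/
noncomputable def supply : (G.edges → ℝ) →ₗ[ℝ] I₀ → ℝ :=
  FunOnFinite.linearMap ℝ ℝ fun f : G.edges => f.1.1

/-- The amounts that the vertices of side `1` receive along their edges in total. -/
noncomputable def load : (G.edges → ℝ) →ₗ[ℝ] I₁ → ℝ :=
  FunOnFinite.linearMap ℝ ℝ fun f : G.edges => f.1.2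

/-- The amounts received by the vertices of side `1`, relative to their weights. -/
noncomputable def density (x : G.edges → ℝ) (j : I₁) : ℝ := G.load x j / G.w₁ j

/-- The quantity to be minimized in order to balance the densities of side `1`. -/
noncomputable def energy (x : G.edges → ℝ) : ℝ := ∑ j, G.load x j ^ 2 / G.w₁ j

/-- A refinement of side `0` of least energy. -/
def IsEnergyMinimizer (α : FinDist G.edges) : Prop :=
  G.IsRefinement₀ α ∧ ∀ β : FinDist G.edges, G.IsRefinement₀ β → G.energy α.1 ≤ G.energy β.1

/-- A Wardrop equilibrium: each vertex of side `0` sends its weight only to neighbours whose density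
is least among its neighbours. -/
def IsEquilibrium (α : FinDist G.edges) : Prop :=
  G.IsRefinement₀ α ∧
    ∀ f g : G.edges, f.1.1 = g.1.1 → α.1 f ≠ 0 → G.density α.1 f.1.2 ≤ G.density α.1 g.1.2

/-- The distribution of the weights of side `1` among the edges in proportion to the amounts `x`. -/
noncomputable def proportionalSplit (x : G.edges → ℝ) (f : G.edges) : ℝ :=
  x f / G.density x f.1.2

theorem supply_apply [DecidableEq I₀] (x : G.edges → ℝ) (i : I₀) :
    G.supply x i = ∑ f : G.edges with f.1.1 = i, x f :=
  FunOnFinite.linearMap_apply_apply ..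

theorem load_apply [DecidableEq I₁] (x : G.edges → ℝ) (j : I₁) :
    G.load x j = ∑ f : G.edges with f.1.2 = j, x f :=
  FunOnFinite.linearMap_apply_apply ..

theorem load_mem_stdSimplex (α : FinDist G.edges) : G.load α.1 ∈ stdSimplex ℝ I₁ :=
  (stdSimplex.map (fun f : G.edges => f.1.2) α).2

theorem le_load (α : FinDist G.edges) (f : G.edges) : α.1 f ≤ G.load α.1 f.1.2 := by
  classical
  rw [load_apply]
  exact single_le_sum (fun g _ => α.2.1 g) (by simp)

theorem w₀_mem_stdSimplex : G.w₀ ∈ stdSimplex ℝ I₀ := ⟨fun i => (G.w₀_pos i).le, G.sum_w₀⟩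

theorem w₁_mem_stdSimplex : G.w₁ ∈ stdSimplex ℝ I₁ := ⟨fun j => (G.w₁_pos j).le, G.sum_w₁⟩

theorem load_proportionalSplit {x : G.edges → ℝ} (hx : ∀ j, 0 < G.load x j) :
    G.load (G.proportionalSplit x) = G.w₁ := by
  refine (linearMap_mul_comp (fun f : G.edges => f.1.2) (fun j => (G.density x j)⁻¹) x).trans ?_
  ext j
  rw [density, inv_div]
  exact mul_div_cancel₀ _ (hx j).ne'

variable {G}

theorem NoIsolated.isRefinement₀_iff (hG : G.NoIsolated) {α : FinDist G.edges} :
    G.IsRefinement₀ α ↔ G.supply α.1 = G.w₀ := by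
  classical
  simp only [IsRefinement₀, hG.1, forall_const, funext_iff, supply_apply]

theorem NoIsolated.isRefinement₁_iff (hG : G.NoIsolated) {α : FinDist G.edges} :
    G.IsRefinement₁ α ↔ G.load α.1 = G.w₁ := by
  classical
  simp only [IsRefinement₁, hG.2, forall_const, funext_iff, load_apply]

theorem IsRefinement₀.sum_mul (hG : G.NoIsolated) {α : FinDist G.edges} (hα : G.IsRefinement₀ α)
    (a : I₀ → ℝ) : ∑ f : G.edges, a f.1.1 * α.1 f = ∑ i, a i * G.w₀ i := by
  rw [← hG.isRefinement₀_iff.1 hα]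
  exact sum_comp_mul_eq_sum_mul_linearMap (fun f : G.edges => f.1.1) a α.1

theorem IsRefinement₁.sum_mul (hG : G.NoIsolated) {α : FinDist G.edges} (hα : G.IsRefinement₁ α)
    (b : I₁ → ℝ) : ∑ f : G.edges, b f.1.2 * α.1 f = ∑ j, b j * G.w₁ j := by
  rw [← hG.isRefinement₁_iff.1 hα]
  exact sum_comp_mul_eq_sum_mul_linearMap (fun f : G.edges => f.1.2) b α.1

theorem NoIsolated.exists_isRefinement₀ (hG : G.NoIsolated) :
    ∃ α : FinDist G.edges, G.IsRefinement₀ α := by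
  choose c hc using hG.1
  let s : I₀ → G.edges := fun i => ⟨(i, c i), hc i⟩
  let w : FinDist I₀ := ⟨G.w₀, G.w₀_mem_stdSimplex⟩
  refine ⟨stdSimplex.map s w, hG.isRefinement₀_iff.2 ?_⟩
  have h := stdSimplex.map_comp_apply (S := ℝ) s (fun f : G.edges => f.1.1) w
  exact congrArg Subtype.val (h.trans (stdSimplex.map_id_apply w))

theorem NoIsolated.card_fst_le (hG : G.NoIsolated) : Fintype.card I₀ ≤ #G.edges := by
  have hsurj : Surjective fun f : G.edges => f.1.1 := fun i =>
    let ⟨j, hij⟩ := hG.1 i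
    ⟨⟨(i, j), hij⟩, rfl⟩
  simpa using Fintype.card_le_of_surjective _ hsurj

theorem NoIsolated.card_snd_le (hG : G.NoIsolated) : Fintype.card I₁ ≤ #G.edges := by
  have hsurj : Surjective fun f : G.edges => f.1.2 := fun j =>
    let ⟨i, hij⟩ := hG.2 j
    ⟨⟨(i, j), hij⟩, rfl⟩
  simpa using Fintype.card_le_of_surjective _ hsurj

theorem NoIsolated.edges_nonempty (hG : G.NoIsolated) : G.edges.Nonempty := by
  obtain ⟨i, -⟩ := nonempty_of_sum_ne_zero (G.sum_w₀.trans_ne one_ne_zero)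
  exact (hG.1 i).imp' _ fun _ => id

theorem NoIsolated.exists_isEnergyMinimizer (hG : G.NoIsolated) :
    ∃ α : FinDist G.edges, G.IsEnergyMinimizer α := by
  have hclosed : IsClosed {α : FinDist G.edges | G.IsRefinement₀ α} := by
    simp only [hG.isRefinement₀_iff]
    exact isClosed_eq
      (G.supply.continuous_of_finiteDimensional.comp continuous_subtype_val) continuous_const
  have hcont : Continuous fun α : FinDist G.edges => G.energy α.1 := by
    have hload := G.load.continuous_of_finiteDimensional.comp
      (continuous_subtype_val (p := (· ∈ stdSimplex ℝ G.edges)))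
    exact continuous_finsetSum _ fun j _ =>
      (((continuous_apply j).comp hload).pow 2).div_const (G.w₁ j)
  exact hclosed.isCompact.exists_isMinOn hG.exists_isRefinement₀ hcont.continuousOn

theorem IsEnergyMinimizer.sum_density_mul_nonneg (hG : G.NoIsolated) {α β : FinDist G.edges}
    (hα : G.IsEnergyMinimizer α) (hβ : G.IsRefinement₀ β) :
    0 ≤ ∑ j, G.density α.1 j * (G.load β.1 j - G.load α.1 j) := by
  let s : Set (G.edges → ℝ) := stdSimplex ℝ G.edges ∩ G.supply ⁻¹' {G.w₀}
  have hs : Convex ℝ s :=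
    (convex_stdSimplex ℝ _).inter ((convex_singleton G.w₀).linear_preimage G.supply)
  refine sum_div_mul_sub_nonneg (hs.linear_image G.load) ?_
    ⟨α.1, ⟨α.2, hG.isRefinement₀_iff.1 hα.1⟩, rfl⟩ ⟨β.1, ⟨β.2, hG.isRefinement₀_iff.1 hβ⟩, rfl⟩
  rintro _ ⟨x, ⟨hx, hxw⟩, rfl⟩
  exact hα.2 ⟨x, hx⟩ (hG.isRefinement₀_iff.2 hxw)

theorem IsEnergyMinimizer.isEquilibrium (hG : G.NoIsolated) {α : FinDist G.edges}
    (hα : G.IsEnergyMinimizer α) : G.IsEquilibrium α := by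
  classical
  refine ⟨hα.1, fun f g hfg hf => ?_⟩
  let shift : G.edges → ℝ := Pi.single g (α.1 f) - Pi.single f (α.1 f)
  have hsupply : G.supply (α.1 + shift) = G.w₀ := by
    simp [shift, supply, hfg, ← hG.isRefinement₀_iff.1 hα.1]
  have hload : G.load (α.1 + shift) - G.load α.1 =
      Pi.single g.1.2 (α.1 f) - Pi.single f.1.2 (α.1 f) := by
    simp [shift, load]
  have hnonneg (e : G.edges) : 0 ≤ (α.1 + shift) e := by
    have := α.2.1 e
    have := α.2.1 f
    by_cases hef : e = f <;> by_cases heg : e = g <;> simp_all [shift, add_nonneg]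
  let β : FinDist G.edges :=
    ⟨α.1 + shift, mem_stdSimplex_of_linearMap_mem hnonneg (hsupply ▸ G.w₀_mem_stdSimplex)⟩
  have h := hα.sum_density_mul_nonneg hG (β := β) (hG.isRefinement₀_iff.2 hsupply)
  simp only [β, ← Pi.sub_apply, hload] at h
  have hgain : 0 ≤ (G.density α.1 g.1.2 - G.density α.1 f.1.2) * α.1 f := by
    simpa [Pi.single_apply, mul_sub, sub_mul] using h
  exact sub_nonneg.1 (nonneg_of_mul_nonneg_left hgain ((α.2.1 f).lt_of_ne' hf))

theorem IsEquilibrium.exists_potential (hG : G.NoIsolated) {α : FinDist G.edges}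
    (hα : G.IsEquilibrium α) : ∃ σ : I₀ → ℝ, (∀ i, 0 < σ i) ∧
      (∀ f : G.edges, σ f.1.1 ≤ G.density α.1 f.1.2) ∧
      ∀ f : G.edges, α.1 f ≠ 0 → σ f.1.1 = G.density α.1 f.1.2 := by
  classical
  have hused (i : I₀) : ∃ f : G.edges, f.1.1 = i ∧ α.1 f ≠ 0 := by
    have hi := (hα.1 i (hG.1 i)).trans_ne (G.w₀_pos i).ne'
    simpa using exists_ne_zero_of_sum_ne_zero hi
  choose s hs hsα using hused
  refine ⟨fun i => G.density α.1 (s i).1.2, fun i => ?_, fun f => hα.2 _ _ (hs _) (hsα _),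
    fun f hf => (hα.2 _ _ (hs _) (hsα _)).antisymm (hα.2 _ _ (hs _).symm hf)⟩
  exact div_pos (((α.2.1 _).lt_of_ne' (hsα i)).trans_le (G.le_load α _)) (G.w₁_pos _)

theorem IsEquilibrium.load_pos (hG : G.NoIsolated) {α : FinDist G.edges}
    (hα : G.IsEquilibrium α) (j : I₁) : 0 < G.load α.1 j := by
  obtain ⟨σ, hpos, hle, -⟩ := hα.exists_potential hG
  obtain ⟨i, hij⟩ := hG.2 j
  have hdensity : 0 < G.density α.1 j := (hpos i).trans_le (hle ⟨(i, j), hij⟩)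
  exact (div_pos_iff_of_pos_right (G.w₁_pos j)).1 hdensity

theorem IsEquilibrium.exists_eq_proportionalSplit (hG : G.NoIsolated) {α₀ : FinDist G.edges}
    (hα₀ : G.IsEquilibrium α₀) : ∃ α₁ : FinDist G.edges, α₁.1 = G.proportionalSplit α₀.1 := by
  have hload := G.load_proportionalSplit (hα₀.load_pos hG)
  exact ⟨⟨_, mem_stdSimplex_of_linearMap_mem
    (fun f => div_nonneg (α₀.2.1 f) (div_nonneg (hα₀.load_pos hG _).le (G.w₁_pos _).le))
    (hload ▸ G.w₁_mem_stdSimplex)⟩, rfl⟩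

section Closest

variable {α₀ α₁ : FinDist G.edges} (hG : G.NoIsolated) (hα₀ : G.IsEquilibrium α₀)
  (hα₁ : α₁.1 = G.proportionalSplit α₀.1)

include hG hα₀ hα₁

theorem IsEquilibrium.isRefinementPair : G.IsRefinementPair α₀ α₁ :=
  ⟨hα₀.1, hG.isRefinement₁_iff.2 <| hα₁ ▸ G.load_proportionalSplit (hα₀.load_pos hG)⟩

-- If `y r` maximizes `r * u + v`, where `r` stands for a likelihood ratio, then `y ∘ ρ` is an
-- optimal decision rule for the pair `(α₀, α₁)`. The rule `y ∘ σ` does as well against any other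
-- pair.
theorem IsEquilibrium.exists_sum_le {β₀ β₁ : FinDist G.edges} (hβ : G.IsRefinementPair β₀ β₁)
    (u v : G.edges → ℝ) : ∃ d : G.edges → G.edges,
      ∑ f, u f * α₀.1 f + ∑ f, v f * α₁.1 f ≤
        ∑ f, u (d f) * β₀.1 f + ∑ f, v (d f) * β₁.1 f := by
  obtain ⟨σ, hσ, hσρ, hσρ'⟩ := hα₀.exists_potential hG
  have hα : G.IsRefinementPair α₀ α₁ := hα₀.isRefinementPair hG hα₁
  set ρ := G.density α₀.1
  have hρ (f : G.edges) : 0 < ρ f.1.2 := (hσ _).trans_le (hσρ f)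
  have hratio (f : G.edges) : α₀.1 f = ρ f.1.2 * α₁.1 f := by
    rw [hα₁]
    exact (mul_div_cancel₀ _ (hρ f).ne').symm
  have : Nonempty G.edges :=
    univ_nonempty_iff.1 (nonempty_of_sum_ne_zero (α₀.2.2.trans_ne one_ne_zero))
  choose y hy using fun r : ℝ => Finite.exists_max fun f => r * u f + v f
  refine ⟨fun f => y (σ f.1.1), ?_⟩
  calc ∑ f, u f * α₀.1 f + ∑ f, v f * α₁.1 f
      ≤ ∑ f : G.edges, u (y (ρ f.1.2)) * α₀.1 f + ∑ f : G.edges, v (y (ρ f.1.2)) * α₁.1 f :=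
        sum_add_sum_le_of_forall_mul_add_le hy α₁.2.1 hratio id
    _ = ∑ f : G.edges, u (y (σ f.1.1)) * α₀.1 f + ∑ f : G.edges, v (y (ρ f.1.2)) * α₁.1 f := by
        congr! 2 with f
        by_cases hf : α₀.1 f = 0
        · simp [hf]
        · rw [hσρ' f hf]
    _ = ∑ f : G.edges, u (y (σ f.1.1)) * β₀.1 f + ∑ f : G.edges, v (y (ρ f.1.2)) * β₁.1 f := by
        rw [hα.1.sum_mul hG fun i => u (y (σ i)), hβ.1.sum_mul hG fun i => u (y (σ i)),
          hα.2.sum_mul hG fun j => v (y (ρ j)), hβ.2.sum_mul hG fun j => v (y (ρ j))]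
    _ ≤ ∑ f : G.edges, u (y (σ f.1.1)) * β₀.1 f + ∑ f : G.edges, v (y (σ f.1.1)) * β₁.1 f := by
        gcongr with f
        · exact β₁.2.1 f
        · exact antitoneOn_of_forall_mul_add_le hy (hσ _).le (hρ f).le (hσρ f)

theorem IsEquilibrium.isUniversallyClosest : G.IsUniversallyClosest α₀ α₁ := by
  refine ⟨hα₀.isRefinementPair hG hα₁, fun D hD β₀ β₁ hβ => ?_⟩
  obtain ⟨κ, hκ⟩ := exists_process_eq ![β₀, β₁] ![α₀, α₁] fun g => by
    simpa using hα₀.exists_sum_le hG hα₁ hβ (g 0) (g 1)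
  have h₀ : β₀.process κ = α₀ := hκ 0
  have h₁ : β₁.process κ = α₁ := hκ 1
  simpa only [h₀, h₁] using hD G.edges G.edges κ β₀ β₁

end Closest

end DistInstance

namespace FlowNetwork

/-- The net inflow of the vertex `v` under the edge vector `f`. -/
def netInflow (N : FlowNetwork) (f : Fin N.numE → ℝ) (v : ℕ) : ℝ :=
  (∑ e with N.head e = v, f e) - ∑ e with N.tail e = v, f e

end FlowNetwork

namespace DistInstance

variable {n₀ n₁ m : ℕ} (G : DistInstance (Fin n₀) (Fin n₁)) (e : Fin m ≃ G.edges)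

/-- The network in which side `0` sends its weights along the edges of the instance to side `1` and
from there to a common sink, at a cost that is the energy. The vertices of side `0` come first, the
sink is the last vertex, and the edges to the sink are the last edges. -/
noncomputable abbrev flowNetwork : FlowNetwork where
  numV := n₀ + n₁ + 1
  numE := m + n₁
  tail := Fin.append (fun k => ((e k).1.1 : ℕ)) fun j => n₀ + j
  head := Fin.append (fun k => n₀ + ((e k).1.2 : ℕ)) fun _ => n₀ + n₁
  demand := Fin.append (Fin.append (fun i => -G.w₀ i) fun _ => 0) fun _ => 1
  cap _ := 1
  quad := Fin.append (fun _ => 0) fun j => 1 / G.w₁ j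

/-- The part of a flow in `flowNetwork` that lives on the edges of the instance. -/
def edgeFlow (f : Fin (m + n₁) → ℝ) (g : G.edges) : ℝ := f (Fin.castAdd n₁ (e.symm g))

theorem supply_eq_sum (x : G.edges → ℝ) (i : Fin n₀) :
    G.supply x i = ∑ k, if ((e k).1.1 : ℕ) = i then x (e k) else 0 := by
  rw [supply_apply, sum_filter, ← e.sum_comp]
  simp only [Fin.ext_iff]

theorem load_eq_sum (x : G.edges → ℝ) (j : Fin n₁) :
    G.load x j = ∑ k, if ((e k).1.2 : ℕ) = j then x (e k) else 0 := by
  rw [load_apply, sum_filter, ← e.sum_comp]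
  simp only [Fin.ext_iff]

theorem flowNetwork_netInflow (f : Fin (m + n₁) → ℝ) (v : ℕ) :
    (G.flowNetwork e).netInflow f v =
      (∑ k, if n₀ + ((e k).1.2 : ℕ) = v then f (Fin.castAdd n₁ k) else 0) +
        (∑ j, if n₀ + n₁ = v then f (Fin.natAdd m j) else 0) -
        ((∑ k, if ((e k).1.1 : ℕ) = v then f (Fin.castAdd n₁ k) else 0) +
          ∑ j : Fin n₁, if n₀ + (j : ℕ) = v then f (Fin.natAdd m j) else 0) := by
  simp [FlowNetwork.netInflow, sum_filter, Fin.sum_univ_add]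

theorem flowNetwork_netInflow_fst (f : Fin (m + n₁) → ℝ) (i : Fin n₀) :
    (G.flowNetwork e).netInflow f i = -G.supply (G.edgeFlow e f) i := by
  have h (k : ℕ) : n₀ + k ≠ i := by omega
  simp [flowNetwork_netInflow, G.supply_eq_sum e, edgeFlow, h]

theorem flowNetwork_netInflow_snd (f : Fin (m + n₁) → ℝ) (j : Fin n₁) :
    (G.flowNetwork e).netInflow f (n₀ + j) =
      G.load (G.edgeFlow e f) j - f (Fin.natAdd m j) := by
  have h (i : Fin n₀) : (i : ℕ) ≠ n₀ + j := by omega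
  simp [flowNetwork_netInflow, G.load_eq_sum e, edgeFlow, h, j.2.ne', ← Fin.ext_iff]

theorem flowNetwork_netInflow_sink (f : Fin (m + n₁) → ℝ) :
    (G.flowNetwork e).netInflow f (n₀ + n₁) = ∑ j, f (Fin.natAdd m j) := by
  have h (i : Fin n₀) : (i : ℕ) ≠ n₀ + n₁ := by omega
  have h' (j : Fin n₁) : (j : ℕ) ≠ n₁ := j.2.ne
  simp [flowNetwork_netInflow, h, h']

theorem flowNetwork_isFlow_iff (f : Fin (m + n₁) → ℝ) :
    (G.flowNetwork e).IsFlow f ↔ (∀ a, 0 ≤ f a ∧ f a ≤ 1) ∧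
      G.supply (G.edgeFlow e f) = G.w₀ ∧ (G.load (G.edgeFlow e f) = fun j => f (Fin.natAdd m j)) ∧
      ∑ j, f (Fin.natAdd m j) = 1 := by
  refine and_congr_right fun _ => ?_
  change (∀ v : Fin (n₀ + n₁ + 1), (G.flowNetwork e).netInflow f v = (G.flowNetwork e).demand v) ↔ _
  rw [Fin.forall_fin_add, Fin.forall_fin_add]
  simp [flowNetwork_netInflow_fst, flowNetwork_netInflow_snd, flowNetwork_netInflow_sink,
    funext_iff, sub_eq_zero, and_assoc]

theorem flowNetwork_cost (f : Fin (m + n₁) → ℝ) :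
    (G.flowNetwork e).cost f = ∑ j, f (Fin.natAdd m j) ^ 2 / G.w₁ j := by
  simp [FlowNetwork.cost, Fin.sum_univ_add, div_eq_inv_mul]

variable {G}

theorem IsRefinement₀.isFlow (hG : G.NoIsolated) {α : FinDist G.edges} (hα : G.IsRefinement₀ α) :
    (G.flowNetwork e).IsFlow (Fin.append (fun k => α.1 (e k)) (G.load α.1)) := by
  have hedge : G.edgeFlow e (Fin.append (fun k => α.1 (e k)) (G.load α.1)) = α.1 := by
    ext g
    simp [edgeFlow]
  have hload := G.load_mem_stdSimplex α
  simp only [flowNetwork_isFlow_iff, hedge, Fin.append_right, hload.2, and_true]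
  refine ⟨Fin.addCases (fun k => ?_) fun j => ?_, hG.isRefinement₀_iff.1 hα⟩
  · simpa only [Fin.append_left] using Set.mem_Icc.1 (mem_Icc_of_mem_stdSimplex α.2 (e k))
  · simpa only [Fin.append_right] using Set.mem_Icc.1 (mem_Icc_of_mem_stdSimplex hload j)

theorem exists_isEnergyMinimizer_of_isOptimal (hG : G.NoIsolated) {f : Fin (m + n₁) → ℝ}
    (hf : (G.flowNetwork e).IsOptimal f) : ∃ α : FinDist G.edges, G.IsEnergyMinimizer α ∧
      (∀ k, f (Fin.castAdd n₁ k) = α.1 (e k)) ∧ ∀ j, f (Fin.natAdd m j) = G.load α.1 j := by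
  obtain ⟨hbound, hsupply, hload, -⟩ := (G.flowNetwork_isFlow_iff e f).1 hf.1
  let α : FinDist G.edges := ⟨G.edgeFlow e f, mem_stdSimplex_of_linearMap_mem
    (fun g => (hbound _).1) (hsupply ▸ G.w₀_mem_stdSimplex)⟩
  refine ⟨α, ⟨hG.isRefinement₀_iff.2 hsupply, fun β hβ => ?_⟩, fun k => ?_,
    fun j => congrFun hload.symm j⟩
  · simpa [flowNetwork_cost, energy, α, hload] using hf.2 _ (hβ.isFlow e hG)
  · simp [α, edgeFlow]

variable (G) in
theorem flowNetwork_isProper (hG : G.NoIsolated) : (G.flowNetwork e).IsProper := by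
  obtain ⟨α, hα⟩ := hG.exists_isRefinement₀
  refine ⟨Fin.addCases (fun k => ?_) fun j => ?_, fun _ => zero_le_one,
    Fin.addCases (fun k => ?_) fun j => ?_, _, hα.isFlow e hG⟩
  · simp only [Fin.append_left]
    omega
  · simp only [Fin.append_right]
    omega
  · simp
  · simp [(G.w₁_pos j).le]

include e in
theorem NoIsolated.sizes_le (hG : G.NoIsolated) : n₀ ≤ m ∧ n₁ ≤ m ∧ 1 ≤ m := by
  have hm : #G.edges = m := by simpa using (Fintype.card_congr e).symm
  have h₀ := hG.card_fst_le
  have h₁ := hG.card_snd_le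
  rw [Fintype.card_fin, hm] at h₀ h₁
  exact ⟨h₀, h₁, hm ▸ hG.edges_nonempty.card_pos⟩

theorem NoIsolated.flowNetwork_size_le (hG : G.NoIsolated) : (G.flowNetwork e).size ≤ 5 * m := by
  have := hG.sizes_le e
  change n₀ + n₁ + 1 + (m + n₁) ≤ 5 * m
  omega

end DistInstance

namespace NearLinear

variable {S T : ℕ → ℕ}

theorem const_mul_id (C : ℕ) : NearLinear fun n => C * n := fun ε hε => by
  refine .of_bound C ?_
  filter_upwards [Filter.eventually_ge_atTop 1] with n hn
  have hpow : (n : ℝ) ≤ (n : ℝ) ^ (1 + ε) :=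
    Real.self_le_rpow_of_one_le (by exact_mod_cast hn) (by linarith)
  rw [Real.norm_natCast, Real.norm_of_nonneg (by positivity), Nat.cast_mul]
  gcongr

theorem add (hS : NearLinear S) (hT : NearLinear T) : NearLinear fun n => S n + T n :=
  fun ε hε => by simpa using (hS ε hε).add (hT ε hε)

theorem comp_const_mul (hT : NearLinear T) {C : ℕ} (hC : 0 < C) :
    NearLinear fun n => T (C * n) := fun ε hε => by
  refine ((hT ε hε).comp_tendsto (Filter.tendsto_id.const_mul_atTop' hC)).trans
    (.of_bound ((C : ℝ) ^ (1 + ε)) (.of_forall fun n => ?_))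
  simp [Real.mul_rpow, Real.abs_rpow_of_nonneg]

theorem partialSups (hT : NearLinear T) : NearLinear (partialSups T) := fun ε hε => by
  obtain ⟨K, hK, hbound⟩ := Asymptotics.bound_of_isBigO_nat_atTop (hT ε hε)
  refine .of_bound (T 0 + K) ?_
  filter_upwards [Filter.eventually_ge_atTop 1] with n hn
  obtain ⟨k, hkn, hk⟩ := exists_partialSups_eq T n
  rw [hk, Real.norm_natCast, Real.norm_of_nonneg (by positivity), add_mul]
  rcases k.eq_zero_or_pos with rfl | hpos
  · have hpow : 1 ≤ (n : ℝ) ^ (1 + ε) :=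
      Real.one_le_rpow (by exact_mod_cast hn) (by linarith)
    exact (le_mul_of_one_le_right (by positivity) hpow).trans
      (le_add_of_nonneg_right (by positivity))
  · calc (T k : ℝ) ≤ K * (k : ℝ) ^ (1 + ε) := by
          simpa [Real.abs_rpow_of_nonneg] using hbound (x := k) (by positivity)
      _ ≤ K * (n : ℝ) ^ (1 + ε) := by gcongr
      _ ≤ T 0 * (n : ℝ) ^ (1 + ε) + K * (n : ℝ) ^ (1 + ε) :=
          le_add_of_nonneg_left (by positivity)

end NearLinear

section Fill

variable {X : Type*}

/-- The array `a` with the entries `g 0, …, g (n - 1)` written to the `n` cells from `o` on. -/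
def fill (o n : ℕ) (g a : ℕ → X) (k : ℕ) : X := if o ≤ k ∧ k < o + n then g (k - o) else a k

theorem fill_zero (o : ℕ) (g a : ℕ → X) : fill o 0 g a = a := by
  ext k
  grind [fill]

theorem fill_succ (o n : ℕ) (g a : ℕ → X) :
    fill o (n + 1) g a = update (fill o n g a) (o + n) (g n) := by
  ext k
  grind [fill]

end Fill

namespace Memory

variable (s : Memory)

/-- The memory after the sizes of the network and the demand of the sink have been entered. -/
@[simp]
noncomputable def withSizes : Memory where
  ireg := update (update (update s.ireg 5 (s.ireg 2 + s.ireg 3)) 0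
    (s.ireg 2 + s.ireg 3 + 1)) 1 (s.ireg 4 + s.ireg 3)
  rreg := update s.rreg 1 1
  iarr := s.iarr
  rarr := update s.rarr 0 (update (s.rarr 0) (s.ireg 2 + s.ireg 3) 1)

/-- The memory after the demands of the first `n` vertices of side `0` have been entered. -/
@[simp]
noncomputable def withDemands (n : ℕ) : Memory :=
  { s with
    rarr := update s.rarr 0 (fill 0 n (fun i => s.rreg 0 - s.rarr 4 i) (s.rarr 0)) }

/-- The memory after the first `n` edges of the instance have been entered. -/
@[simp]
noncomputable def withEdges (n : ℕ) : Memory :=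
  { s with
    iarr := update (update s.iarr 0 (fill 0 n (s.iarr 2) (s.iarr 0)))
      1 (fill 0 n (fun k => s.ireg 2 + s.iarr 3 k) (s.iarr 1))
    rarr := update s.rarr 1 (fill 0 n (fun _ => s.rreg 1) (s.rarr 1)) }

/-- The memory after the first `n` edges to the sink have been entered. -/
@[simp]
noncomputable def withSinkEdges (n : ℕ) : Memory :=
  { s with
    iarr := update (update s.iarr 0 (fill (s.ireg 4) n (fun j => s.ireg 2 + j) (s.iarr 0)))
      1 (fill (s.ireg 4) n (fun _ => s.ireg 5) (s.iarr 1))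
    rarr := update (update s.rarr 1 (fill (s.ireg 4) n (fun _ => s.rreg 1) (s.rarr 1)))
      2 (fill (s.ireg 4) n (fun j => s.rreg 1 / s.rarr 5 j) (s.rarr 2)) }

/-- The memory after the whole network has been entered. -/
noncomputable def withNetwork : Memory :=
  s.withSizes.withDemands (s.ireg 2) |>.withEdges (s.ireg 4) |>.withSinkEdges (s.ireg 3)

/-- The memory after a call of the solver. -/
@[simp]
noncomputable def withAnswer (S : FlowSolver) : Memory :=
  { s with
    rarr := update s.rarr 3 fun k =>
      if h : k < s.network.numE then S s.network ⟨k, h⟩ else s.rarr 3 k }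

/-- The memory after the two refinements have been computed on the first `n` edges. -/
@[simp]
noncomputable def withOutput (n : ℕ) : Memory :=
  { s with
    rarr := update (update s.rarr 6 (fill 0 n (s.rarr 3) (s.rarr 6)))
      7 (fill 0 n
        (fun k => s.rarr 3 k / (s.rarr 3 (s.ireg 4 + s.iarr 3 k) / s.rarr 5 (s.iarr 3 k)))
        (s.rarr 7)) }

theorem withDemands_zero : s.withDemands 0 = s := by
  simp [fill_zero]

theorem withEdges_zero : s.withEdges 0 = s := by
  simp [fill_zero]

theorem withSinkEdges_zero : s.withSinkEdges 0 = s := by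
  simp [fill_zero]

theorem withOutput_zero : s.withOutput 0 = s := by
  simp [fill_zero]

variable {s}

theorem network_eq {N : FlowNetwork} (hV : s.ireg 0 = N.numV) (hE : s.ireg 1 = N.numE)
    (htail : ∀ k : Fin N.numE, s.iarr 0 k = N.tail k)
    (hhead : ∀ k : Fin N.numE, s.iarr 1 k = N.head k)
    (hdemand : ∀ v : Fin N.numV, s.rarr 0 v = N.demand v)
    (hcap : ∀ k : Fin N.numE, s.rarr 1 k = N.cap k)
    (hquad : ∀ k : Fin N.numE, s.rarr 2 k = N.quad k) : s.network = N := by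
  obtain ⟨V, E, tail, head, demand, cap, quad⟩ := N
  dsimp only at hV hE
  subst hV hE
  simp [network, htail, hhead, hdemand, hcap, hquad]

theorem withAnswer_rarr_three (S : FlowSolver) {N : FlowNetwork} (hN : s.network = N)
    (k : Fin N.numE) : (s.withAnswer S).rarr 3 k = S N k := by
  subst hN
  simp

end Memory

/-- The start of the iteration `k` of a loop with the counter `x`. -/
def Run.iterate (r : Run) (x k : ℕ) : Run := r.step { r.mem with ireg := update r.mem.ireg x k }

theorem Program.exec_loop_induction (S : FlowSolver) (x b : ℕ) (p : Program) (r : Run)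
    (Inv : ℕ → Run → Prop) (h₀ : Inv 0 (r.step r.mem))
    (hs : ∀ k < r.mem.ireg b, ∀ r', Inv k r' → Inv (k + 1) (p.exec S (r'.iterate x k))) :
    Inv (r.mem.ireg b) ((loop x b p).exec S r) := by
  rw [exec]
  generalize r.mem.ireg b = n at hs ⊢
  induction n with
  | zero => exact h₀
  | succ n ih =>
    rw [List.range_succ, List.foldl_append]
    exact hs n n.lt_succ_self _ (ih fun k hk => hs k (by omega))

/-- The runs agree up to the contents of scratch registers, which are the index registers from `7`
on and the real registers from `2` on. -/
structure Run.Agree (r r' : Run) : Prop where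
  steps : r.steps = r'.steps
  queries : r.queries = r'.queries
  ireg : ∀ x < 7, r.mem.ireg x = r'.mem.ireg x
  rreg : ∀ x < 2, r.mem.rreg x = r'.mem.rreg x
  iarr : r.mem.iarr = r'.mem.iarr
  rarr : r.mem.rarr = r'.mem.rarr

namespace Program

local infixr:60 " ;; " => Program.seq

/-- Enter the sizes of the network and the demand of the sink. -/
def header : Program :=
  iadd 5 2 3 ;; iconst 0 1 ;; iadd 0 5 0 ;; iadd 1 4 3 ;; rconst 1 1 ;; rstore 0 5 1

/-- Enter the demand of a vertex of side `0`. -/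
def demandBody : Program :=
  rload 2 4 7 ;; rop .sub 2 0 2 ;; rstore 0 7 2

/-- Enter an edge of the instance, with capacity one. Its cost coefficient is the initial content
`0` of its cell. -/
def edgeBody : Program :=
  iload 8 2 7 ;; istore 0 7 8 ;; iload 8 3 7 ;; iadd 8 2 8 ;; istore 1 7 8 ;; rstore 1 7 1

/-- Enter the edge from a vertex of side `1` to the sink. -/
def sinkBody : Program :=
  iadd 8 4 7 ;; iadd 9 2 7 ;; istore 0 8 9 ;; istore 1 8 5 ;; rstore 1 8 1 ;; rload 2 5 7 ;;
    rop .div 2 1 2 ;; rstore 2 8 2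

/-- Compute the two refinements on an edge of the instance. -/
def outputBody : Program :=
  rload 2 3 7 ;; rstore 6 7 2 ;; iload 8 3 7 ;; iadd 9 4 8 ;; rload 3 3 9 ;; rload 4 5 8 ;;
    rop .div 3 3 4 ;; rop .div 2 2 3 ;; rstore 7 7 2

/-- Compute a universally closest refinement pair by a call of the flow solver. -/
def closestPair : Program :=
  header ;; loop 7 2 demandBody ;; loop 7 4 edgeBody ;; loop 7 3 sinkBody ;; solve ;;
    loop 7 4 outputBody

variable {S : FlowSolver} {r : Run} {s : Memory} {t : ℕ} {q : List FlowNetwork}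

theorem exec_header_agree : (header.exec S ⟨s, t, q⟩).Agree ⟨s.withSizes, t + 6, q⟩ := by
  constructor <;> intros <;>
    simp (disch := omega) [header, exec, Run.step]

theorem exec_demandBody_agree {k : ℕ} (h : r.Agree ⟨s.withDemands k, t, q⟩) :
    (demandBody.exec S (r.iterate 7 k)).Agree ⟨s.withDemands (k + 1), t + 4, q⟩ := by
  constructor <;> intros <;>
    simp (disch := omega) [demandBody, exec, Run.iterate, Run.step, RealOp.eval, h.steps,
      h.queries, h.ireg, h.rreg, h.iarr, h.rarr, fill_succ]

theorem exec_edgeBody_agree {k : ℕ} (h : r.Agree ⟨s.withEdges k, t, q⟩) :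
    (edgeBody.exec S (r.iterate 7 k)).Agree ⟨s.withEdges (k + 1), t + 7, q⟩ := by
  constructor <;> intros <;>
    simp (disch := omega) [edgeBody, exec, Run.iterate, Run.step, h.steps,
      h.queries, h.ireg, h.rreg, h.iarr, h.rarr, fill_succ,
      update_comm (show (1 : ℕ) ≠ 0 by decide)]

theorem exec_sinkBody_agree {k : ℕ} (h : r.Agree ⟨s.withSinkEdges k, t, q⟩) :
    (sinkBody.exec S (r.iterate 7 k)).Agree ⟨s.withSinkEdges (k + 1), t + 9, q⟩ := by
  constructor <;> intros <;>
    simp (disch := omega) [sinkBody, exec, Run.iterate, Run.step, RealOp.eval, h.steps,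
      h.queries, h.ireg, h.rreg, h.iarr, h.rarr, fill_succ,
      update_comm (show (1 : ℕ) ≠ 0 by decide),
      update_comm (show (2 : ℕ) ≠ 1 by decide)]

theorem exec_outputBody_agree {k : ℕ} (h : r.Agree ⟨s.withOutput k, t, q⟩) :
    (outputBody.exec S (r.iterate 7 k)).Agree ⟨s.withOutput (k + 1), t + 10, q⟩ := by
  constructor <;> intros <;>
    simp (disch := omega) [outputBody, exec, Run.iterate, Run.step, RealOp.eval, h.steps,
      h.queries, h.ireg, h.rreg, h.iarr, h.rarr, fill_succ,
      update_comm (show (7 : ℕ) ≠ 6 by decide)]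

theorem exec_loop_agree {F : ℕ → Memory} {p : Program} {b c : ℕ}
    (hp : ∀ {r : Run} {t k : ℕ}, r.Agree ⟨F k, t, q⟩ →
      (p.exec S (r.iterate 7 k)).Agree ⟨F (k + 1), t + c, q⟩)
    (hF : F 0 = s) (hb : b < 7) (h : r.Agree ⟨s, t, q⟩) :
    ((loop 7 b p).exec S r).Agree ⟨F (s.ireg b), t + 1 + c * s.ireg b, q⟩ := by
  rw [← show r.mem.ireg b = s.ireg b from h.ireg b hb]
  refine exec_loop_induction S 7 b p r (fun k r => r.Agree ⟨F k, t + 1 + c * k, q⟩) ?_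
    fun k _ r' h' => by simpa only [mul_add_one, add_assoc] using hp h'
  rw [hF]
  exact { h with steps := congrArg (· + 1) h.steps }

theorem exec_solve_agree (h : r.Agree ⟨s, t, q⟩) :
    (solve.exec S r).Agree ⟨s.withAnswer S, t + 1, q ++ [s.network]⟩ := by
  have hN : r.mem.network = s.network := Memory.network_eq (h.ireg 0 (by norm_num))
    (h.ireg 1 (by norm_num)) (fun _ => by rw [h.iarr]; rfl) (fun _ => by rw [h.iarr]; rfl)
    (fun _ => by rw [h.rarr]; rfl) (fun _ => by rw [h.rarr]; rfl) (fun _ => by rw [h.rarr]; rfl)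
  exact
    { steps := congrArg (· + 1) h.steps
      queries := congrArg₂ (· ++ [·]) h.queries hN
      ireg := h.ireg
      rreg := h.rreg
      iarr := h.iarr
      rarr := by rw [exec, hN, h.rarr]; rfl }

theorem exec_closestPair_agree : (closestPair.exec S ⟨s, t, q⟩).Agree
    ⟨(s.withNetwork.withAnswer S).withOutput (s.ireg 4),
      t + (11 + 4 * s.ireg 2 + 17 * s.ireg 4 + 9 * s.ireg 3), q ++ [s.withNetwork.network]⟩ := by
  have hdemands := exec_loop_agree (S := S) (F := s.withSizes.withDemands) (b := 2)
    exec_demandBody_agree (Memory.withDemands_zero _) (by norm_num)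
    (exec_header_agree (S := S) (t := t) (q := q))
  have hedges := exec_loop_agree (S := S) (F := Memory.withEdges _) (b := 4)
    exec_edgeBody_agree (Memory.withEdges_zero _) (by norm_num) hdemands
  have hsink := exec_loop_agree (S := S) (F := Memory.withSinkEdges _) (b := 3)
    exec_sinkBody_agree (Memory.withSinkEdges_zero _) (by norm_num) hedges
  have houtput := exec_loop_agree (S := S) (F := Memory.withOutput _) (b := 4)
    exec_outputBody_agree (Memory.withOutput_zero _) (by norm_num)
    (exec_solve_agree (S := S) hsink)
  have hsteps : t + (11 + 4 * s.ireg 2 + 17 * s.ireg 4 + 9 * s.ireg 3) =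
      t + 6 + 1 + 4 * s.ireg 2 + 1 + 7 * s.ireg 4 + 1 + 9 * s.ireg 3 + 1 + 1 + 10 * s.ireg 4 := by
    ring
  rw [hsteps]
  exact houtput

end Program

namespace DistInstance

variable {n₀ n₁ m : ℕ} (G : DistInstance (Fin n₀) (Fin n₁)) (e : Fin m ≃ G.edges)

theorem network_encode_withNetwork : (G.encode e).withNetwork.network = G.flowNetwork e := by
  refine Memory.network_eq rfl rfl (Fin.addCases (fun k => ?_) fun j => ?_)
    (Fin.addCases (fun k => ?_) fun j => ?_)
    (Fin.addCases (Fin.addCases (fun i => ?_) fun j => ?_) fun _ => ?_)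
    (Fin.addCases (fun k => ?_) fun j => ?_) (Fin.addCases (fun k => ?_) fun j => ?_)
  all_goals
    simp [flowNetwork, Memory.withNetwork, encode, fill, fun j : Fin n₁ => j.2.ne]

variable {G e}

theorem run_closestPair_agree (S : FlowSolver) :
    (Program.closestPair.run S G e).Agree
      ⟨((G.encode e).withNetwork.withAnswer S).withOutput m, 11 + 4 * n₀ + 17 * m + 9 * n₁,
        [G.flowNetwork e]⟩ := by
  have h := Program.exec_closestPair_agree (S := S) (s := G.encode e) (t := 0) (q := [])
  rw [network_encode_withNetwork, zero_add] at h
  exact h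

theorem NoIsolated.steps_closestPair_le (hG : G.NoIsolated) (S : FlowSolver) :
    (Program.closestPair.run S G e).steps ≤ 41 * m := by
  have := hG.sizes_le e
  rw [(run_closestPair_agree S).steps]
  change 11 + 4 * n₀ + 17 * m + 9 * n₁ ≤ 41 * m
  omega

theorem exists_returns_of_isOptimal (hG : G.NoIsolated) {S : FlowSolver}
    (hS : (G.flowNetwork e).IsOptimal (S (G.flowNetwork e))) : ∃ α₀ α₁ : FinDist G.edges,
      (Program.closestPair.run S G e).Returns e α₀ α₁ ∧ G.IsUniversallyClosest α₀ α₁ := by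
  obtain ⟨α₀, hmin, hedge, hload⟩ := exists_isEnergyMinimizer_of_isOptimal e hG hS
  have hα₀ := hmin.isEquilibrium hG
  obtain ⟨α₁, hα₁⟩ := hα₀.exists_eq_proportionalSplit hG
  refine ⟨α₀, α₁, fun k => ?_, hα₀.isUniversallyClosest hG hα₁⟩
  set s := (G.encode e).withNetwork.withAnswer S
  have hanswer := Memory.withAnswer_rarr_three S (network_encode_withNetwork G e)
  have hk : s.rarr 3 k = α₀.1 (e k) := (hanswer (Fin.castAdd n₁ k)).trans (hedge k)
  have hj : s.rarr 3 (m + (e k).1.2) = G.load α₀.1 (e k).1.2 :=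
    (hanswer (Fin.natAdd m (e k).1.2)).trans (hload _)
  have hm : s.ireg 4 = m := rfl
  have hend : s.iarr 3 k = (e k).1.2 := by
    simp [s, Memory.withNetwork, encode]
  have hweight (j : Fin n₁) : s.rarr 5 j = G.w₁ j := by
    simp [s, Memory.withNetwork, encode]
  have hrun : (Program.closestPair.run S G e).mem.rarr = (s.withOutput m).rarr :=
    (run_closestPair_agree S).rarr
  clear_value s
  simp [hrun, hα₁, fill, hk, hj, hm, hend, hweight, proportionalSplit, density]

end DistInstance

end ClosestRefinement

theorem theorem1 :
    -- existence of a universally closest refinement pair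
    (∀ (I₀ I₁ : Type u) [Fintype I₀] [Fintype I₁] (G : DistInstance I₀ I₁), G.NoIsolated →
      ∃ α₀ α₁ : FinDist G.edges, G.IsUniversallyClosest α₀ α₁) ∧
    -- its computation by means of a solver for minimum quadratic-cost flow
    ∃ p : Program,
      (∃ C : ℕ, ∀ (S : FlowSolver) (n₀ n₁ m : ℕ) (G : DistInstance (Fin n₀) (Fin n₁))
        (e : Fin m ≃ G.edges), G.NoIsolated →
          (p.run S G e).steps ≤ C * m ∧
          ∃ N : FlowNetwork, (p.run S G e).queries = [N] ∧ N.IsProper ∧ N.size ≤ C * m ∧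
            (N.IsOptimal (S N) → ∃ α₀ α₁ : FinDist G.edges,
              (p.run S G e).Returns e α₀ α₁ ∧ G.IsUniversallyClosest α₀ α₁)) ∧
      (∀ T : ℕ → ℕ, NearLinear T → ∃ T' : ℕ → ℕ, NearLinear T' ∧
        ∀ (S : FlowSolver) (n₀ n₁ m : ℕ) (G : DistInstance (Fin n₀) (Fin n₁))
          (e : Fin m ≃ G.edges), G.NoIsolated → (p.run S G e).time T ≤ T' m) := by
  refine ⟨fun I₀ I₁ _ _ G hG => ?_, Program.closestPair, ⟨41, fun S n₀ n₁ m G e hG => ?_⟩,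
    fun T hT => ?_⟩
  · obtain ⟨α₀, hmin⟩ := hG.exists_isEnergyMinimizer
    have hα₀ := hmin.isEquilibrium hG
    obtain ⟨α₁, hα₁⟩ := hα₀.exists_eq_proportionalSplit hG
    exact ⟨α₀, α₁, hα₀.isUniversallyClosest hG hα₁⟩
  · have hsize : (G.flowNetwork e).size ≤ 41 * m :=
      (hG.flowNetwork_size_le e).trans (Nat.mul_le_mul_right m (by norm_num))
    exact ⟨hG.steps_closestPair_le S, _, (DistInstance.run_closestPair_agree S).queries,
      G.flowNetwork_isProper e hG, hsize, DistInstance.exists_returns_of_isOptimal hG⟩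
  · refine ⟨fun m => 41 * m + partialSups T (5 * m), (NearLinear.const_mul_id 41).add
      (hT.partialSups.comp_const_mul (by norm_num)), fun S n₀ n₁ m G e hG => ?_⟩
    rw [Run.time, (DistInstance.run_closestPair_agree S).queries, List.map_singleton,
      List.sum_singleton]
    exact add_le_add (hG.steps_closestPair_le S)
      (le_partialSups_of_le T (hG.flowNetwork_size_le e))
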